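/- Let $d\ge 2$ and let $\mathbb{T}_d$ be the homogeneous tree in which every vertex has $d+1$ neighbours. In the self-avoiding frog model on $\mathbb{T}_d$ with parameter $p\in(0,1)$ there is one particle at each vertex; at time $0$ only the particle at the root is active. When it is activated, a particle starts a self-avoiding random walk from its vertex (each jump goes to a uniformly chosen neighbour of the current position that the walk has not yet visited), makes a geometric number of jumps (exactly $k$ jumps with probability $(1-p)p^k$, $k\ge 0$) and is then removed; all walks and lifetimes are independent. An inactive particle becomes active when an active particle jumps to its vertex. The model survives if at every time there is at least one active particle. Let $$p_c^{\mathrm{sa}}(d)=\inf\{p\in(0,1):\text{the model survives with positive probability}\}.$$ For every $d\in\{2,3,4,\dots\}$ the set in this definition is non-empty. Moreover $$p_c^{\mathrm{sa}}(2)\le 0.648046,$$ and for every $d\ge 3$, with $c=\frac{d}{d+1}$ and $F(c,d)=7d(c+1)^3-8c^2$, $$p_c^{\mathrm{sa}}(d)\le (d+1)^2\,\frac{F(c,d)-\sqrt{F(c,d)^2-224\,c^2(c+1)^2}}{16\,d}.$$ These bounds improve the earlier bound $\frac{2d+1-\sqrt{4d^2-3}}{2}$: $0.648046$ is strictly smaller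 than its value at $d=2$, and for every $d\ge3$ the right-hand side of the last display is strictly smaller than it. -/

import Mathlib

open MeasureTheory ProbabilityTheory

/-! ### The homogeneous tree -/

/-- Vertices of the homogeneous tree of degree `d + 1`: words over an alphabet with `d + 1` letters
in which consecutive letters are distinct. -/
@[ext]
structure TreeVertex (d : ℕ) : Type where
  /-- The word. -/
  word : List (Fin (d + 1))
  isChain : word.IsChain (fun a b => a ≠ b)

instance TreeVertex.instCountable (d : ℕ) : Countable (TreeVertex d) :=
  Function.Injective.countable (f := TreeVertex.word) (fun _ _ h => TreeVertex.ext h)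

instance TreeVertex.instMeasurableSpace (d : ℕ) : MeasurableSpace (TreeVertex d) := ⊤

instance TreeVertex.instDiscreteMeasurableSpace (d : ℕ) :
    DiscreteMeasurableSpace (TreeVertex d) := ⟨fun _ => trivial⟩

/-- The root of the tree: the empty word. -/
def treeRoot (d : ℕ) : TreeVertex d := ⟨[], List.isChain_nil⟩

/-- The homogeneous tree of degree `d + 1`: two words are adjacent iff one of them is obtained from
the other one by putting one letter in front of it. -/
def homTree (d : ℕ) : SimpleGraph (TreeVertex d) where
  Adj v w := (∃ a, w.word = a :: v.word) ∨ (∃ a, v.word = a :: w.word)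
  symm := ⟨fun _ _ h => h.symm⟩
  loopless := ⟨fun v h => by
    rcases h with ⟨a, h⟩ | ⟨a, h⟩ <;> simpa using congrArg List.length h⟩

/-- Every vertex of `homTree d` has exactly `d + 1` neighbours. -/
theorem homTree_ncard_neighborSet (d : ℕ) (v : TreeVertex d) :
    ((homTree d).neighborSet v).ncard = d + 1 := by
  classical
  -- the neighbour of `v` in the direction of the letter `a`
  let f : Fin (d + 1) → TreeVertex d := fun a =>
    if h : v.word.head? = some a then ⟨v.word.tail, v.isChain.tail⟩
    else ⟨a :: v.word, List.isChain_cons.2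
      ⟨fun b hb hab => h (by rw [hab]; exact hb), v.isChain⟩⟩
  have hf1 : ∀ a, v.word.head? = some a → (f a).word = v.word.tail := fun a h => by simp [f, h]
  have hf2 : ∀ a, v.word.head? ≠ some a → (f a).word = a :: v.word := fun a h => by simp [f, h]
  have hf : Function.Injective f := by
    intro a a' h
    have hw := congrArg TreeVertex.word h
    have hlen := congrArg List.length hw
    by_cases h1 : v.word.head? = some a <;> by_cases h2 : v.word.head? = some a'
    · exact Option.some.inj (h1.symm.trans h2)
    · rw [hf1 a h1, hf2 a' h2, List.length_tail, List.length_cons] at hlen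
      omega
    · rw [hf2 a h1, hf1 a' h2, List.length_tail, List.length_cons] at hlen
      omega
    · rw [hf2 a h1, hf2 a' h2] at hw
      exact (List.cons.inj hw).1
  have hr : (homTree d).neighborSet v = Set.range f := by
    ext w
    constructor
    · rintro (⟨a, h⟩ | ⟨a, h⟩)
      · have hne : v.word.head? ≠ some a := by
          have hc := w.isChain
          rw [h, List.isChain_cons] at hc
          exact fun h' => hc.1 a h' rfl
        exact ⟨a, TreeVertex.ext ((hf2 a hne).trans h.symm)⟩
      · exact ⟨a, TreeVertex.ext ((hf1 a (by rw [h]; rfl)).trans (by rw [h]; rfl))⟩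
    · rintro ⟨a, rfl⟩
      by_cases h1 : v.word.head? = some a
      · refine Or.inr ⟨a, ?_⟩
        rw [hf1 a h1]
        exact (List.cons_head?_tail h1).symm
      · exact Or.inl ⟨a, hf2 a h1⟩
  rw [hr, ← Set.image_univ, Set.ncard_image_of_injective _ hf, Set.ncard_univ]
  simp

/-- `homTree d` is a tree. -/
theorem homTree_isTree (d : ℕ) : (homTree d).IsTree := by
  have hreach : ∀ (l : List (Fin (d + 1))) (hl : l.IsChain (fun a b => a ≠ b)),
      (homTree d).Reachable (treeRoot d) ⟨l, hl⟩ := by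
    intro l
    induction l with
    | nil => exact fun _ => SimpleGraph.Reachable.refl _
    | cons a t ih =>
      intro hl
      exact (ih hl.tail).trans (SimpleGraph.Adj.reachable (Or.inl ⟨a, rfl⟩))
  have hbridge : ∀ (v w : TreeVertex d) (a : Fin (d + 1)), w.word = a :: v.word →
      ¬ ((homTree d).deleteEdges {s(v, w)}).Reachable w v := by
    intro v w a hw
    have hstep : ∀ x y : TreeVertex d, ((homTree d).deleteEdges {s(v, w)}).Adj x y →
        w.word <:+ x.word → w.word <:+ y.word := by
      intro x y hxy hx
      rw [SimpleGraph.deleteEdges_adj] at hxy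
      obtain ⟨hadj, hne⟩ := hxy
      rcases hadj with ⟨b, h⟩ | ⟨b, h⟩
      · rw [h]
        exact hx.trans (List.suffix_cons b x.word)
      · rw [h, List.suffix_cons_iff] at hx
        rcases hx with hx | hx
        · exfalso
          have hxw : x = w := TreeVertex.ext (h.trans hx.symm)
          have hyv : y = v := by
            rw [hw, List.cons.injEq] at hx
            exact TreeVertex.ext hx.2.symm
          exact hne (by simp [hxw, hyv, Sym2.eq_swap])
        · exact hx
    rintro ⟨q⟩
    have hq : ∀ (x y : TreeVertex d) (_ : ((homTree d).deleteEdges {s(v, w)}).Walk x y),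
        w.word <:+ x.word → w.word <:+ y.word := by
      intro x y q
      induction q with
      | nil => exact id
      | cons h _ ih => exact fun hx => ih (hstep _ _ h hx)
    have hlen := (hq w v q List.suffix_rfl).length_le
    rw [hw] at hlen
    simp at hlen
  refine ⟨(SimpleGraph.connected_iff_exists_forall_reachable _).2
    ⟨treeRoot d, fun v => hreach v.word v.isChain⟩, ?_⟩
  rw [SimpleGraph.isAcyclic_iff_forall_adj_isBridge]
  intro v w hvw
  rw [SimpleGraph.isBridge_iff]
  rcases hvw with ⟨a, h⟩ | ⟨a, h⟩
  · exact fun hr => hbridge v w a h hr.symm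
  · rw [Sym2.eq_swap]
    exact fun hr => hbridge w v a h hr

/-! ### Self-avoiding random walk -/

section Walk

variable {V : Type*} (G : SimpleGraph V)

/-- The neighbours of the current position `x n` that have not been visited by the path
`x 0, …, x n`. -/
def freshNeighbors (n : ℕ) (x : Finset.Iic n → V) : Set V :=
  {w | G.Adj (x ⟨n, Finset.mem_Iic.2 le_rfl⟩) w ∧ ∀ i, x i ≠ w}

variable [MeasurableSpace V]

open Classical in
/-- The law of the next position of the self-avoiding random walk after the path `x 0, …, x n`:
uniform on the unvisited neighbours of `x n` (and the walk stays at `x n` if there is no uniform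
law on that set, which never happens along a self-avoiding path of `homTree d` if `d ≥ 1`). -/
noncomputable def sawStep (n : ℕ) (x : Finset.Iic n → V) : Measure V :=
  if (freshNeighbors G n x).Finite ∧ (freshNeighbors G n x).Nonempty then
    uniformOn (freshNeighbors G n x)
  else Measure.dirac (x ⟨n, Finset.mem_Iic.2 le_rfl⟩)

variable [DiscreteMeasurableSpace V] [Countable V]

/-- `sawStep` as a Markov kernel from the past to the next position. -/
noncomputable def sawKernel (n : ℕ) : Kernel (Finset.Iic n → V) V :=
  Kernel.ofFunOfCountable (sawStep G n)

instance sawKernel.instIsMarkovKernel (n : ℕ) : IsMarkovKernel (sawKernel G n) := by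
  refine ⟨fun x => ?_⟩
  change IsProbabilityMeasure (sawStep G n x)
  unfold sawStep
  split_ifs with h
  · exact isProbabilityMeasure_uniformOn h.1 h.2
  · infer_instance

/-- The law of the whole trajectory of the self-avoiding random walk on `G` started at `v`. -/
noncomputable def sawLaw (v : V) : Measure (ℕ → V) :=
  Kernel.traj (X := fun _ => V) (sawKernel G) 0 (fun _ => v)

instance sawLaw.instIsProbabilityMeasure (v : V) : IsProbabilityMeasure (sawLaw G v) := by
  unfold sawLaw
  infer_instance

end Walk

/-! ### The frog model -/

/-- The status of a particle: inactive, active and having made `k` jumps so far, or removed. -/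
inductive FrogStatus : Type
  | inactive : FrogStatus
  | active (k : ℕ) : FrogStatus
  | removed : FrogStatus

section Frog

variable {V : Type*}

open Classical in
/-- The status at time `t` of the particle that starts at vertex `v`. Each vertex carries one
particle; the particle of `u` has trajectory `(ω u).1` (starting at `u`) and makes `(ω u).2` jumps
before it is removed. At time `0` only the particle of the vertex `o` is active. An inactive
particle becomes active when an active particle jumps to its vertex. -/
noncomputable def frogStatus (o : V) (ω : V → (ℕ → V) × ℕ) : ℕ → V → FrogStatus
  | 0, v => if v = o then .active 0 else .inactive
  | t + 1, v =>
    match frogStatus o ω t v with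
    | .inactive =>
      if ∃ u k, frogStatus o ω t u = .active k ∧ k < (ω u).2 ∧ (ω u).1 (k + 1) = v then
        .active 0
      else .inactive
    | .active k => if k < (ω v).2 then .active (k + 1) else .removed
    | .removed => .removed

/-- The frog model survives: at every time there is at least one active particle. -/
def FrogSurvives (o : V) (ω : V → (ℕ → V) × ℕ) : Prop :=
  ∀ t, ∃ v k, frogStatus o ω t v = .active k

variable [MeasurableSpace V] [DiscreteMeasurableSpace V] [Countable V]

/-- The law of the randomness of the self-avoiding frog model on `G`: all trajectories and all
lifetimes are independent, the trajectory of the particle of `v` is a self-avoiding random walk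
started at `v`, and the lifetimes are geometric with parameter `1 - p`, that is, the lifetime
is `k` with probability `(1 - p) * p ^ k`. -/
noncomputable def safLaw (G : SimpleGraph V) (p : unitInterval) : Measure (V → (ℕ → V) × ℕ) :=
  Measure.infinitePi (fun v => (sawLaw G v).prod (geometricMeasure (unitInterval.symm p)))

/-- The survival probability of the self-avoiding frog model on `G`, with one particle per vertex
and initially only the particle of `o` active. -/
noncomputable def safSurvivalProb (G : SimpleGraph V) (o : V) (p : unitInterval) : ℝ :=
  (safLaw G p).real {ω | FrogSurvives o ω}

end Frog

/-- The set of all `p ∈ (0, 1)` for which the self-avoiding frog model on the homogeneous tree of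
degree `d + 1` survives with positive probability. -/
def safSurvivalSet (d : ℕ) : Set ℝ :=
  {x | ∃ p : unitInterval, (p : ℝ) = x ∧ 0 < p ∧ p < 1 ∧
    0 < safSurvivalProb (homTree d) (treeRoot d) p}

/-- The critical parameter of the self-avoiding frog model on the homogeneous tree of degree
`d + 1`. -/
noncomputable def safCriticalParam (d : ℕ) : ℝ := sInf (safSurvivalSet d)

/-! ### The explicit bounds -/

/-- `F(c, d) = 7 d (c + 1) ^ 3 - 8 c ^ 2`. -/
noncomputable def boundF (c d : ℝ) : ℝ := 7 * d * (c + 1) ^ 3 - 8 * c ^ 2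

/-- The new upper bound, with `c = d / (d + 1)`. -/
noncomputable def newBound (d : ℝ) : ℝ :=
  let c : ℝ := d / (d + 1)
  (d + 1) ^ 2 * (boundF c d - √(boundF c d ^ 2 - 224 * c ^ 2 * (c + 1) ^ 2)) / (16 * d)

/-- The previously known upper bound. -/
noncomputable def oldBound (d : ℝ) : ℝ := (2 * d + 1 - √(4 * d ^ 2 - 3)) / 2

/-! Only jumps away from the root are used. A particle makes its first $k\ge1$ jumps along a
prescribed descending path with probability $cs^k$, where $c=d/(d+1)$ and $s=p/d$
(`safLaw_reachEvent`).

Fix such a path and let $\alpha_n$ be the probability that its $n$-th vertex is woken by particles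
following the path (`PathChain`). Splitting according to the nearest vertex whose particle reaches
position $n+1$, and using independence of the particles before, at and after that vertex, gives a
renewal inequality for $\alpha_n$ (`safLaw_pathChain_succ_ge`). For $a_n=d^n\alpha_n$ its weights
are $h_m=cp^{m+1}(1-\sum_{j<m}cs^{j+1})$. If $\sum h_m>1$, then $a_n$ grows geometrically
(`exists_two_le_of_renewal`), so for some $n$ a woken vertex wakes on average at least two of $d^n$
descendants $n$ levels below. Disjoint subtrees use disjoint particles, so the woken vertices
contain a supercritical branching process (`infinitePi_real_branching`). It yields infinitely many
woken vertices with positive probability, hence survival.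

Summing the weights turns $\sum h_m>1$ into the explicit criterion of `mem_safSurvivalSet`. For
$d=2$ it is checked numerically. For $d\ge3$ it is implied by a quadratic equation whose smaller
root is `newBound` (`newBound_spec`). -/

/-! ### Descending paths in the tree -/

section Tree

variable {d : ℕ}

/-- `succAbove` skips the letter leading back to the parent. At the root the default `0` discards
one of the $d+1$ neighbours, so every vertex has exactly $d$ labelled children. -/
theorem TreeVertex.isChain_child (v : TreeVertex d) (i : Fin d) :
    ((v.word.headD 0).succAbove i :: v.word).IsChain (fun a b => a ≠ b) := by
  refine List.isChain_cons.2 ⟨fun b hb => ?_, v.isChain⟩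
  have : v.word.headD 0 = b := by
    rw [List.headD_eq_head?_getD, Option.mem_def.1 hb]; rfl
  rw [this]
  exact Fin.succAbove_ne b i

/-- The child of `v` with label `i`. -/
def TreeVertex.child (v : TreeVertex d) (i : Fin d) : TreeVertex d :=
  ⟨(v.word.headD 0).succAbove i :: v.word, v.isChain_child i⟩

/-- The descending path started at `v` with labels `f 0, f 1, …`. -/
def descPath (v : TreeVertex d) (f : ℕ → Fin d) : ℕ → TreeVertex d
  | 0 => v
  | n + 1 => (descPath v f n).child (f n)

theorem TreeVertex.child_word (v : TreeVertex d) (i : Fin d) :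
    (v.child i).word = (v.word.headD 0).succAbove i :: v.word := rfl

theorem TreeVertex.child_eq_child {v w : TreeVertex d} {i j : Fin d}
    (h : v.child i = w.child j) : v = w ∧ i = j := by
  have hw := congrArg TreeVertex.word h
  rw [TreeVertex.child_word, TreeVertex.child_word, List.cons.injEq] at hw
  obtain rfl : v = w := TreeVertex.ext hw.2
  exact ⟨rfl, Fin.succAbove_right_injective hw.1⟩

theorem descPath_succ (v : TreeVertex d) (f : ℕ → Fin d) (n : ℕ) :
    descPath v f (n + 1) = (descPath v f n).child (f n) := rfl

theorem descPath_add (v : TreeVertex d) (f : ℕ → Fin d) (m n : ℕ) :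
    descPath v f (m + n) = descPath (descPath v f m) (fun j => f (m + j)) n := by
  induction n with
  | zero => rfl
  | succ n ih => rw [← add_assoc, descPath_succ, descPath_succ, ih]

theorem length_descPath (v : TreeVertex d) (f : ℕ → Fin d) (n : ℕ) :
    (descPath v f n).word.length = v.word.length + n := by
  induction n with
  | zero => rfl
  | succ n ih => rw [descPath_succ, TreeVertex.child_word, List.length_cons, ih]; ring

theorem suffix_descPath (v : TreeVertex d) (f : ℕ → Fin d) (n : ℕ) :
    v.word <:+ (descPath v f n).word := by
  induction n with
  | zero => exact List.suffix_rfl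
  | succ n ih => exact ih.trans (List.suffix_cons _ _)

theorem eq_of_descPath_eq (v : TreeVertex d) {f g : ℕ → Fin d} {n : ℕ}
    (h : descPath v f n = descPath v g n) : ∀ j < n, f j = g j := by
  induction n with
  | zero => intro j hj; omega
  | succ n ih =>
    intro j hj
    obtain ⟨h1, h2⟩ := TreeVertex.child_eq_child h
    rcases Nat.lt_succ_iff_lt_or_eq.1 hj with hj | rfl
    · exact ih h1 j hj
    · exact h2

theorem homTree_adj_descPath (v : TreeVertex d) (f : ℕ → Fin d) (n : ℕ) :
    (homTree d).Adj (descPath v f n) (descPath v f (n + 1)) :=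
  Or.inl ⟨_, rfl⟩

theorem freshNeighbors_descPath_zero (v : TreeVertex d) (f : ℕ → Fin d) :
    freshNeighbors (homTree d) 0 (fun i => descPath v f i) = (homTree d).neighborSet v := by
  ext w
  refine ⟨fun h => h.1, fun h => ⟨h, ?_⟩⟩
  rintro ⟨i, hi⟩
  obtain rfl : i = 0 := by simpa using hi
  exact SimpleGraph.Adj.ne ((SimpleGraph.mem_neighborSet _ _ _).1 h)

/-- A neighbour with a longer word exceeds the length of everything visited, and the only neighbour
with a shorter word is the previous position. -/
theorem freshNeighbors_descPath_succ (v : TreeVertex d) (f : ℕ → Fin d) (n : ℕ) :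
    freshNeighbors (homTree d) (n + 1) (fun i => descPath v f i) =
      (homTree d).neighborSet (descPath v f (n + 1)) \ {descPath v f n} := by
  ext w
  constructor
  · rintro ⟨h1, h2⟩
    exact ⟨h1, fun h => h2 ⟨n, by simp⟩ h.symm⟩
  · rintro ⟨h1, h2⟩
    refine ⟨h1, ?_⟩
    rintro ⟨i, hi⟩ hw
    rw [Finset.mem_Iic] at hi
    rcases h1 with ⟨a, h⟩ | ⟨a, h⟩
    · have hl := congrArg List.length h
      rw [← hw] at hl
      simp only [length_descPath, List.length_cons] at hl
      omega
    · apply h2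
      rw [descPath_succ, TreeVertex.child_word, List.cons.injEq] at h
      exact TreeVertex.ext h.2.symm

theorem ncard_freshNeighbors_descPath_succ (v : TreeVertex d) (f : ℕ → Fin d) (n : ℕ) :
    (freshNeighbors (homTree d) (n + 1) (fun i => descPath v f i)).ncard = d := by
  rw [freshNeighbors_descPath_succ, Set.ncard_sdiff_singleton_of_mem, homTree_ncard_neighborSet]
  · rfl
  · exact (homTree_adj_descPath v f n).symm

theorem descPath_succ_mem_freshNeighbors (v : TreeVertex d) (f : ℕ → Fin d) (n : ℕ) :
    descPath v f (n + 1) ∈ freshNeighbors (homTree d) n (fun i => descPath v f i) := by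
  refine ⟨homTree_adj_descPath v f n, ?_⟩
  rintro ⟨i, hi⟩ hw
  rw [Finset.mem_Iic] at hi
  have := congrArg (fun w => w.word.length) hw
  simp only [length_descPath] at this
  omega

end Tree

/-! ### The self-avoiding walk follows a given path -/

theorem uniformOn_singleton_of_mem {V : Type*} [MeasurableSpace V] [MeasurableSingletonClass V]
    {s : Set V} (hs : s.Finite) {a : V} (ha : a ∈ s) :
    uniformOn s {a} = (s.ncard : ENNReal)⁻¹ := by
  rw [uniformOn, cond_apply hs.measurableSet, Set.inter_eq_right.2 (Set.singleton_subset_iff.2 ha),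
    Measure.count_singleton, mul_one, Measure.count_apply_finite _ hs, Set.ncard_eq_toFinset_card s hs]

section Walk

variable {V : Type*} (G : SimpleGraph V) [MeasurableSpace V] [DiscreteMeasurableSpace V]
  [Countable V]

theorem sawLaw_prefix_zero (x : ℕ → V) :
    sawLaw G (x 0) {y | ∀ l ≤ 0, y l = x l} = 1 := by
  have h := Kernel.traj_map_frestrictLe_apply (κ := sawKernel G) (X := fun _ => V) 0 0
    (fun _ => x 0)
  have hs : {y : ℕ → V | ∀ l ≤ 0, y l = x l} =
      Preorder.frestrictLe (π := fun _ => V) 0 ⁻¹' {fun _ => x 0} := by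
    ext y
    simp only [Nat.le_zero, forall_eq, Set.mem_ofPred_eq, Set.mem_preimage, Set.mem_singleton_iff,
      funext_iff]
    constructor
    · rintro h ⟨i, hi⟩
      obtain rfl : i = 0 := by simpa using hi
      exact h
    · exact fun h => h ⟨0, by simp⟩
  rw [hs, ← Measure.map_apply (by fun_prop) (measurableSet_singleton _), sawLaw, h,
    Kernel.partialTraj_self, Kernel.id_apply, Measure.dirac_apply_of_mem (Set.mem_singleton _)]

/-- The joint law of the prefix and the next position is the prefix law composed with `sawKernel`;
it is evaluated on a product of singletons. -/
theorem sawLaw_prefix_succ (v : V) (x : ℕ → V) (n : ℕ) :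
    sawLaw G v {y | ∀ l ≤ n + 1, y l = x l} =
      sawLaw G v {y | ∀ l ≤ n, y l = x l} * sawStep G n (fun i => x i) {x (n + 1)} := by
  have h := Kernel.partialTraj_compProd_eq_map_traj (κ := sawKernel G) (X := fun _ => V)
    (Nat.zero_le n) (x₀ := fun _ => v)
  have hs : {y : ℕ → V | ∀ l ≤ n, y l = x l} =
      Preorder.frestrictLe (π := fun _ => V) n ⁻¹' {fun i : Finset.Iic n => x i} := by
    ext y
    simp only [Set.mem_ofPred_eq, Set.mem_preimage, Set.mem_singleton_iff, funext_iff]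
    exact ⟨fun h i => h i (Finset.mem_Iic.1 i.2), fun h l hl => h ⟨l, Finset.mem_Iic.2 hl⟩⟩
  have hs' : {y : ℕ → V | ∀ l ≤ n + 1, y l = x l} =
      (fun y : ℕ → V => (Preorder.frestrictLe (π := fun _ => V) n y, y (n + 1))) ⁻¹'
        ({fun i : Finset.Iic n => x i} ×ˢ {x (n + 1)}) := by
    rw [Set.mk_preimage_prod, ← hs]
    ext y
    simp only [Set.mem_ofPred_eq, Set.mem_inter_iff, Set.mem_preimage, Set.mem_singleton_iff]
    refine ⟨fun h => ⟨fun l hl => h l (by omega), h _ le_rfl⟩, fun h l hl => ?_⟩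
    rcases Nat.le_succ_iff.1 hl with hl | rfl
    · exact h.1 l hl
    · exact h.2
  have hm := Kernel.traj_map_frestrictLe_apply (κ := sawKernel G) (X := fun _ => V) 0 n
    (fun _ => v)
  rw [hs', hs, sawLaw, ← Measure.map_apply (by fun_prop)
    ((measurableSet_singleton _).prod (measurableSet_singleton _)),
    ← Measure.map_apply (by fun_prop) (measurableSet_singleton _), ← h, hm,
    Measure.compProd_apply_prod (measurableSet_singleton _) (measurableSet_singleton _),
    lintegral_singleton, mul_comm]
  rfl

end Walk

theorem sawLaw_descPath {d : ℕ} (hd : d ≠ 0) (v : TreeVertex d) (f : ℕ → Fin d) (n : ℕ) :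
    sawLaw (homTree d) v {y | ∀ l ≤ n + 1, y l = descPath v f l} =
      (((d + 1) * d ^ n : ℕ) : ENNReal)⁻¹ := by
  have hfin : ∀ n, (freshNeighbors (homTree d) n (fun i => descPath v f i)).Finite := by
    intro n
    cases n with
    | zero =>
      refine Set.finite_of_ncard_ne_zero ?_
      rw [freshNeighbors_descPath_zero, homTree_ncard_neighborSet]
      omega
    | succ n =>
      refine Set.finite_of_ncard_ne_zero ?_
      rwa [ncard_freshNeighbors_descPath_succ]
  have hstep : ∀ n, sawStep (homTree d) n (fun i => descPath v f i) {descPath v f (n + 1)} =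
      ((freshNeighbors (homTree d) n (fun i => descPath v f i)).ncard : ENNReal)⁻¹ := by
    intro n
    rw [sawStep, if_pos ⟨hfin n, _, descPath_succ_mem_freshNeighbors v f n⟩,
      uniformOn_singleton_of_mem (hfin n) (descPath_succ_mem_freshNeighbors v f n)]
  induction n with
  | zero =>
    have h0 := sawLaw_prefix_zero (homTree d) (descPath v f)
    rw [show descPath v f 0 = v from rfl] at h0
    rw [sawLaw_prefix_succ, h0, hstep, freshNeighbors_descPath_zero, homTree_ncard_neighborSet]
    simp
  | succ n ih =>
    rw [sawLaw_prefix_succ, ih, hstep, ncard_freshNeighbors_descPath_succ, pow_succ, ← mul_assoc,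
      Nat.cast_mul _ d, ENNReal.mul_inv]
    · exact Or.inr (ENNReal.natCast_ne_top d)
    · exact Or.inr (Nat.cast_ne_zero.2 hd)

theorem geometricMeasure_real_Ici {p : unitInterval} (hp : p < 1) (k : ℕ) :
    (geometricMeasure (unitInterval.symm p)).real (Set.Ici k) = (p : ℝ) ^ k := by
  have hp0 : unitInterval.symm p ≠ 0 := by
    intro h
    exact hp.ne (by simpa using h)
  induction k with
  | zero =>
    have : (Set.Ici 0 : Set ℕ) = Set.univ := by ext; simp
    rw [this]; simp
  | succ k ih =>
    have hset : (Set.Ici k : Set ℕ) = {k} ∪ Set.Ici (k + 1) := by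
      ext m
      simp only [Set.mem_Ici, Set.singleton_union, Set.mem_insert_iff]
      omega
    rw [hset, measureReal_union (by simp) (by measurability),
      geometricMeasure_real_singleton hp0, unitInterval.coe_symm_eq] at ih
    rw [pow_succ]
    linear_combination ih

/-! ### Activation of particles -/

section Activation

variable {V : Type*} {o : V} {ω : V → (ℕ → V) × ℕ}

/-- The particle of `v` becomes active at some time. -/
def Activated (o : V) (ω : V → (ℕ → V) × ℕ) (v : V) : Prop :=
  ∃ t, frogStatus o ω t v = .active 0

theorem frogStatus_succ_of_active {t k : ℕ} {v : V} (h : frogStatus o ω t v = .active k) :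
    frogStatus o ω (t + 1) v = if k < (ω v).2 then .active (k + 1) else .removed := by
  rw [frogStatus, h]

theorem frogStatus_succ_of_removed {t : ℕ} {v : V} (h : frogStatus o ω t v = .removed) :
    frogStatus o ω (t + 1) v = .removed := by
  rw [frogStatus, h]

open Classical in
theorem frogStatus_succ_of_inactive {t : ℕ} {v : V} (h : frogStatus o ω t v = .inactive) :
    frogStatus o ω (t + 1) v =
      if ∃ u k, frogStatus o ω t u = .active k ∧ k < (ω u).2 ∧ (ω u).1 (k + 1) = v then
        .active 0 else .inactive := by
  rw [frogStatus, h]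

theorem frogStatus_add {t : ℕ} {v : V} (h : frogStatus o ω t v = .active 0) {k : ℕ}
    (hk : k ≤ (ω v).2) : frogStatus o ω (t + k) v = .active k := by
  induction k with
  | zero => exact h
  | succ k ih => rw [← add_assoc, frogStatus_succ_of_active (ih (by omega)), if_pos (by omega)]

theorem Activated.of_ne_inactive {t : ℕ} {v : V} (h : frogStatus o ω t v ≠ .inactive) :
    Activated o ω v := by
  induction t with
  | zero =>
    refine ⟨0, ?_⟩
    by_contra h'
    simp only [frogStatus] at h h'
    split_ifs at h h' <;> simp_all
  | succ t ih =>
    by_cases hi : frogStatus o ω t v = .inactive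
    · refine ⟨t + 1, ?_⟩
      rw [frogStatus_succ_of_inactive hi] at h ⊢
      split_ifs at h ⊢
      · rfl
      · exact absurd rfl h
    · exact ih hi

theorem activated_origin : Activated o ω o := ⟨0, by simp [frogStatus]⟩

theorem Activated.jump {v : V} (h : Activated o ω v) {k : ℕ} (hk : k + 1 ≤ (ω v).2) :
    Activated o ω ((ω v).1 (k + 1)) := by
  obtain ⟨t, ht⟩ := h
  by_cases hi : frogStatus o ω (t + k) ((ω v).1 (k + 1)) = .inactive
  · refine ⟨t + k + 1, ?_⟩
    rw [frogStatus_succ_of_inactive hi,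
      if_pos ⟨v, k, frogStatus_add ht (by omega), by omega, rfl⟩]
  · exact .of_ne_inactive hi

/-- In one time step each active particle wakes at most one vertex, namely the one it jumps to. -/
theorem finite_setOf_frogStatus_ne_inactive (o : V) (ω : V → (ℕ → V) × ℕ) (t : ℕ) :
    {v | frogStatus o ω t v ≠ .inactive}.Finite := by
  induction t with
  | zero =>
    refine (Set.finite_singleton o).subset fun v hv => ?_
    by_contra h
    rw [Set.mem_singleton_iff] at h
    exact hv (by simp only [frogStatus]; rw [if_neg h])
  | succ t ih =>
    let g : V → V := fun u => match frogStatus o ω t u with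
      | .active k => (ω u).1 (k + 1)
      | _ => u
    refine (ih.union (ih.image g)).subset fun v hv => ?_
    by_cases hi : frogStatus o ω t v = .inactive
    · right
      have hv' : frogStatus o ω (t + 1) v ≠ .inactive := hv
      rw [frogStatus_succ_of_inactive hi] at hv'
      split_ifs at hv' with hex
      · obtain ⟨u, k, hu, -, huv⟩ := hex
        refine ⟨u, ?_, ?_⟩
        · change frogStatus o ω t u ≠ .inactive
          rw [hu]
          simp
        · simp only [g, hu, huv]
      · exact absurd rfl hv'
    · exact Or.inl hi

/-- If infinitely many particles become active, then the frog model survives. -/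
theorem frogSurvives_of_infinite (h : {v | Activated o ω v}.Infinite) : FrogSurvives o ω := by
  intro T
  by_contra hT
  push Not at hT
  -- With no active particle at time $T$ nothing is woken later, so all particles ever activated are
  -- among the finitely many non-inactive ones at time $T$.
  have hlate : ∀ s, (∀ v k, frogStatus o ω (T + s) v ≠ .active k) ∧
      ∀ v, frogStatus o ω T v = .inactive → frogStatus o ω (T + s) v = .inactive := by
    intro s
    induction s with
    | zero => exact ⟨hT, fun v hv => hv⟩
    | succ s ih =>
      have hin : ∀ v, frogStatus o ω (T + s) v = .inactive →
          frogStatus o ω (T + s + 1) v = .inactive := by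
        intro v hv
        rw [frogStatus_succ_of_inactive hv, if_neg]
        rintro ⟨u, k, hu, -⟩
        exact ih.1 u k hu
      refine ⟨fun v k => ?_, fun v hv => hin v (ih.2 v hv)⟩
      rw [← add_assoc]
      rcases hst : frogStatus o ω (T + s) v with _ | j | _
      · rw [hin v hst]; simp
      · exact absurd hst (ih.1 v j)
      · rw [frogStatus_succ_of_removed hst]; simp
  refine h ((finite_setOf_frogStatus_ne_inactive o ω T).subset ?_)
  rintro v ⟨t, ht⟩ hv
  rcases le_total t T with htT | htT
  · have hpers : ∀ s, frogStatus o ω (t + s) v ≠ .inactive := by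
      intro s
      induction s with
      | zero => rw [add_zero, ht]; simp
      | succ s ih =>
        rcases hst : frogStatus o ω (t + s) v with _ | j | _
        · exact absurd hst ih
        · rw [← add_assoc, frogStatus_succ_of_active hst]
          split_ifs <;> simp
        · rw [← add_assoc, frogStatus_succ_of_removed hst]; simp
    obtain ⟨s, rfl⟩ := Nat.exists_eq_add_of_le htT
    exact hpers s hv
  · obtain ⟨s, rfl⟩ := Nat.exists_eq_add_of_le htT
    exact (hlate s).1 v 0 ht

end Activation

/-! ### Independence of disjoint families of coordinates -/

section Coordinates

variable {ι : Type*} {X : ι → Type*} [∀ i, MeasurableSpace (X i)]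

/-- The `σ`-algebra generated by the coordinates in `S`. -/
@[reducible] def coordSigma (X : ι → Type*) [∀ i, MeasurableSpace (X i)] (S : Set ι) :
    MeasurableSpace (∀ i, X i) :=
  ⨆ i ∈ S, MeasurableSpace.comap (fun ω : ∀ i, X i => ω i) inferInstance

theorem coordSigma_mono {S T : Set ι} (h : S ⊆ T) : coordSigma X S ≤ coordSigma X T :=
  biSup_mono h

theorem coordSigma_le (S : Set ι) : coordSigma X S ≤ MeasurableSpace.pi :=
  iSup₂_le fun i _ => (measurable_pi_apply i).comap_le

theorem measurableSet_coordSigma_preimage {S : Set ι} {i : ι} (hi : i ∈ S) {A : Set (X i)}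
    (hA : MeasurableSet A) :
    MeasurableSet[coordSigma X S] ((fun ω : ∀ i, X i => ω i) ⁻¹' A) :=
  le_iSup₂ (f := fun i (_ : i ∈ S) =>
    MeasurableSpace.comap (fun ω : ∀ i, X i => ω i) inferInstance) i hi _ ⟨A, hA, rfl⟩

variable {P : ∀ i, Measure (X i)} [∀ i, IsProbabilityMeasure (P i)]

theorem infinitePi_real_inter {S T : Set ι} (hST : Disjoint S T) {A B : Set (∀ i, X i)}
    (hA : MeasurableSet[coordSigma X S] A) (hB : MeasurableSet[coordSigma X T] B) :
    (Measure.infinitePi P).real (A ∩ B) =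
      (Measure.infinitePi P).real A * (Measure.infinitePi P).real B := by
  have h := (iIndepFun_infinitePi (P := P) (X := fun _ x => x) fun _ => measurable_id)
  rw [iIndepFun_iff_iIndep] at h
  have h2 := indep_iSup_of_disjoint (fun i => (measurable_pi_apply i).comap_le) h hST
  rw [measureReal_def, Indep_iff .. |>.1 h2 A B hA hB, ENNReal.toReal_mul]
  rfl

/-- For events depending on disjoint families of coordinates, the union over a finite set `B` of
events with probabilities at least `δ` has probability at least `1 - (1 - δ) ^ #B`. -/
theorem infinitePi_real_biInter_compl_le {κ : Type*} (B : Finset κ) {T : κ → Set ι}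
    (hT : Pairwise fun a b => Disjoint (T a) (T b)) {E : κ → Set (∀ i, X i)}
    (hE : ∀ a, MeasurableSet[coordSigma X (T a)] (E a)) {δ : ℝ}
    (hδ : ∀ a, δ ≤ (Measure.infinitePi P).real (E a)) :
    (Measure.infinitePi P).real (⋂ a ∈ B, (E a)ᶜ) ≤ (1 - δ) ^ B.card := by
  classical
  induction B using Finset.induction_on with
  | empty => simp
  | insert a B ha ih =>
    have hdisj : Disjoint (T a) (⋃ b ∈ B, T b) := by
      rw [Set.disjoint_iUnion₂_right]
      intro b hb
      exact hT (by rintro rfl; exact ha hb)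
    have hme : MeasurableSet[coordSigma X (⋃ b ∈ B, T b)] (⋂ b ∈ B, (E b)ᶜ) :=
      Finset.measurableSet_biInter B fun b hb =>
        (coordSigma_mono (Set.subset_biUnion_of_mem (u := fun b => T b) hb) _ (hE b)).compl
    rw [Finset.set_biInter_insert, infinitePi_real_inter hdisj (hE a).compl hme,
      Finset.card_insert_of_notMem ha, pow_succ, mul_comm,
      probReal_compl_eq_one_sub (coordSigma_le _ _ (hE a))]
    have h1 : (Measure.infinitePi P).real (E a) ≤ 1 := measureReal_le_one
    refine mul_le_mul ih (by linarith [hδ a]) (by linarith) ?_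
    exact measureReal_nonneg.trans ih

/-- By Bernoulli, $(1-\delta)^m\le(1+\delta)^{-m}\le1/(1+m\delta)$. Weakening $m$ to $M$ in the
denominator makes the bound linear in $m$, so that it can be averaged over a random $m$. -/
theorem one_sub_pow_le {δ : ℝ} (h0 : 0 ≤ δ) (h1 : δ ≤ 1) {m M : ℕ} (hm : m ≤ M) :
    m * δ / (1 + M * δ) ≤ 1 - (1 - δ) ^ m := by
  have hb : 1 + m * δ ≤ (1 + δ) ^ m := one_add_mul_le_pow (by linarith) m
  have hq : 0 ≤ (1 - δ) ^ m := pow_nonneg (by linarith) m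
  have hprod : (1 - δ) ^ m * (1 + δ) ^ m ≤ 1 := by
    rw [← mul_pow]
    exact pow_le_one₀ (by nlinarith) (by nlinarith)
  have hq1 : (1 - δ) ^ m ≤ 1 := pow_le_one₀ (by linarith) (by linarith)
  have hmM : (m : ℝ) * δ ≤ M * δ := mul_le_mul_of_nonneg_right (by exact_mod_cast hm) h0
  have hmδ : 0 ≤ (m : ℝ) * δ := by positivity
  rw [div_le_iff₀ (by linarith)]
  nlinarith [mul_le_mul_of_nonneg_left hb hq, mul_nonneg (sub_nonneg.2 hq1) (sub_nonneg.2 hmM)]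

/-- One step of a branching process: if the offspring events `A a` are independent of the
independent events `E a`, which have probabilities at least `δ`, and if the mean number of offspring
is at least `1 + M δ`, where `M` is the maximal number of offspring, then the probability that
`A a ∩ E a` occurs for some `a` is at least `δ`. -/
theorem infinitePi_real_branching {κ : Type*} [Fintype κ] {T₀ : Set ι} {T : κ → Set ι}
    (hT₀ : ∀ a, Disjoint T₀ (T a)) (hT : Pairwise fun a b => Disjoint (T a) (T b))
    {A E : κ → Set (∀ i, X i)} (hA : ∀ a, MeasurableSet[coordSigma X T₀] (A a))
    (hE : ∀ a, MeasurableSet[coordSigma X (T a)] (E a)) {δ : ℝ} (h0 : 0 ≤ δ) (h1 : δ ≤ 1)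
    (hδ : ∀ a, δ ≤ (Measure.infinitePi P).real (E a))
    (hmean : 1 + Fintype.card κ * δ ≤ ∑ a, (Measure.infinitePi P).real (A a)) :
    δ ≤ (Measure.infinitePi P).real (⋃ a, A a ∩ E a) := by
  classical
  set μ := Measure.infinitePi P
  -- `L B` says that the set of offspring is exactly `B`; these events are disjoint and independent
  -- of `U B`.
  let L : Finset κ → Set (∀ i, X i) := fun B => ⋂ a, if a ∈ B then A a else (A a)ᶜ
  let U : Finset κ → Set (∀ i, X i) := fun B => ⋃ a ∈ B, E a
  have hL : ∀ B, MeasurableSet[coordSigma X T₀] (L B) := by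
    intro B
    refine MeasurableSet.iInter fun a => ?_
    split_ifs
    · exact hA a
    · exact (hA a).compl
  have memL : ∀ {B ω}, ω ∈ L B ↔ ∀ a, ω ∈ A a ↔ a ∈ B := by
    intro B ω
    simp only [L, Set.mem_iInter]
    refine forall_congr' fun a => ?_
    split_ifs with h <;> simp [h]
  have hUm : ∀ B, MeasurableSet[coordSigma X (⋃ a, T a)] (U B) := fun B =>
    Finset.measurableSet_biUnion B fun a _ =>
      coordSigma_mono (Set.subset_iUnion T a) _ (hE a)
  have hU : ∀ B, B.card * δ / (1 + Fintype.card κ * δ) ≤ μ.real (U B) := by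
    intro B
    have hc : (⋂ a ∈ B, (E a)ᶜ) = (U B)ᶜ := by simp [U]
    have := infinitePi_real_biInter_compl_le (P := P) B hT hE hδ
    rw [hc, probReal_compl_eq_one_sub (coordSigma_le _ _ (hUm B))] at this
    have := one_sub_pow_le h0 h1 (Finset.card_le_univ B)
    linarith
  have hsub : (⋃ B ∈ (Finset.univ : Finset (Finset κ)), L B ∩ U B) ⊆ ⋃ a, A a ∩ E a := by
    intro ω hω
    simp only [Set.mem_iUnion, Set.mem_inter_iff, Finset.mem_univ, exists_prop, true_and, U] at hω ⊢
    obtain ⟨B, hB, a, haB, ha⟩ := hω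
    exact ⟨a, (memL.1 hB a).2 haB, ha⟩
  have hdisj : Set.PairwiseDisjoint ((Finset.univ : Finset (Finset κ)) : Set (Finset κ))
      (fun B => L B ∩ U B) := by
    intro B _ B' _ hne
    refine Set.disjoint_left.2 fun ω h h' => hne ?_
    ext a
    rw [← memL.1 h.1 a, memL.1 h'.1 a]
  have hmeasLU : ∀ B, MeasurableSet (L B ∩ U B) := fun B =>
    (coordSigma_le _ _ (hL B)).inter (coordSigma_le _ _ (hUm B))
  have hAL : ∀ a, μ.real (A a) ≤ ∑ B, if a ∈ B then μ.real (L B) else 0 := by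
    intro a
    rw [← Finset.sum_filter]
    refine le_trans (measureReal_mono ?_ (measure_ne_top _ _)) (measureReal_biUnion_finset_le _ _)
    intro ω hω
    simp only [Set.mem_iUnion, Finset.mem_filter, Finset.mem_univ, true_and]
    exact ⟨Finset.univ.filter fun b => ω ∈ A b, by simpa using hω, memL.2 fun b => by simp⟩
  have hpos : 0 < 1 + Fintype.card κ * δ := by positivity
  -- As the bound on `U B` is linear in the size of `B`, only the mean number of offspring enters;
  -- the events `A a` may depend on each other.
  calc δ ≤ (∑ a, μ.real (A a)) * (δ / (1 + Fintype.card κ * δ)) := by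
        rw [← mul_div_assoc, le_div_iff₀ hpos, mul_comm]
        exact mul_le_mul_of_nonneg_right hmean h0
    _ ≤ (∑ a, ∑ B, if a ∈ B then μ.real (L B) else 0) * (δ / (1 + Fintype.card κ * δ)) :=
        mul_le_mul_of_nonneg_right (Finset.sum_le_sum fun a _ => hAL a) (by positivity)
    _ = ∑ B, μ.real (L B) * (B.card * δ / (1 + Fintype.card κ * δ)) := by
        rw [Finset.sum_comm, Finset.sum_mul]
        refine Finset.sum_congr rfl fun B _ => ?_
        rw [← Finset.sum_filter, Finset.filter_univ_mem, Finset.sum_const, nsmul_eq_mul]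
        ring
    _ ≤ ∑ B, μ.real (L B ∩ U B) := by
        refine Finset.sum_le_sum fun B _ => ?_
        rw [infinitePi_real_inter (Set.disjoint_iUnion_right.2 hT₀) (hL B) (hUm B)]
        exact mul_le_mul_of_nonneg_left (hU B) measureReal_nonneg
    _ = μ.real (⋃ B ∈ (Finset.univ : Finset (Finset κ)), L B ∩ U B) :=
        (measureReal_biUnion_finset hdisj fun B _ => hmeasLU B).symm
    _ ≤ μ.real (⋃ a, A a ∩ E a) := measureReal_mono hsub (measure_ne_top _ _)

end Coordinates

/-! ### Activation along a descending path -/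

section Chain

variable {d : ℕ}

/-- The particle of `v` makes its first `k` jumps along the descending path with labels `f`. -/
def reachEvent (v : TreeVertex d) (f : ℕ → Fin d) (k : ℕ) :
    Set (TreeVertex d → (ℕ → TreeVertex d) × ℕ) :=
  (fun ω => ω v) ⁻¹' ({y | ∀ l ≤ k, y l = descPath v f l} ×ˢ Set.Ici k)

theorem measurableSet_setOf_prefix {V : Type*} [MeasurableSpace V] [MeasurableSingletonClass V]
    (x : ℕ → V) (k : ℕ) : MeasurableSet {y : ℕ → V | ∀ l ≤ k, y l = x l} := by
  simp only [Set.ofPred_forall]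
  exact .iInter fun l => .iInter fun _ =>
    measurable_pi_apply (X := fun _ => V) l (measurableSet_singleton _)

theorem measurableSet_reachEvent (v : TreeVertex d) (f : ℕ → Fin d) (k : ℕ)
    {S : Set (TreeVertex d)} (hv : v ∈ S) :
    MeasurableSet[coordSigma (fun _ : TreeVertex d => (ℕ → TreeVertex d) × ℕ) S]
      (reachEvent v f k) :=
  measurableSet_coordSigma_preimage hv
    ((measurableSet_setOf_prefix _ _).prod .of_discrete)

/-- The factor $d/(d+1)$ appears because the first jump has $d+1$ choices and every later one $d$.
The value depends neither on the vertex nor on the path. -/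
theorem safLaw_reachEvent (hd : d ≠ 0) {p : unitInterval} (hp : p < 1) (v : TreeVertex d)
    (f : ℕ → Fin d) (k : ℕ) :
    (safLaw (homTree d) p).real (reachEvent v f (k + 1)) =
      (d / (d + 1) : ℝ) * (p / d) ^ (k + 1) := by
  have hd' : (d : ℝ) ≠ 0 := Nat.cast_ne_zero.2 hd
  have hm := (measurableSet_setOf_prefix (descPath v f) (k + 1)).prod
    (MeasurableSet.of_discrete (s := Set.Ici (k + 1)))
  rw [safLaw, reachEvent, ← map_measureReal_apply (measurable_pi_apply v) hm,
    Measure.infinitePi_map_eval, measureReal_prod_prod, geometricMeasure_real_Ici hp,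
    measureReal_def, sawLaw_descPath hd, ENNReal.toReal_inv, ENNReal.toReal_natCast]
  push_cast
  rw [div_pow, pow_succ (d : ℝ) k]
  field_simp

/-- The vertices on the descending path `descPath v f` that are activated in succession by
particles on this path which follow the path. -/
inductive PathChain (ω : TreeVertex d → (ℕ → TreeVertex d) × ℕ) (v : TreeVertex d)
    (f : ℕ → Fin d) : ℕ → Prop
  | zero : PathChain ω v f 0
  | step {i n : ℕ} (h : i < n) (hi : PathChain ω v f i)
      (hr : ω ∈ reachEvent (descPath v f i) (fun j => f (i + j)) (n - i)) : PathChain ω v f n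

theorem PathChain.activated {o v : TreeVertex d} {f : ℕ → Fin d}
    {ω : TreeVertex d → (ℕ → TreeVertex d) × ℕ} {n : ℕ} (h : PathChain ω v f n)
    (hv : Activated o ω v) : Activated o ω (descPath v f n) := by
  induction h with
  | zero => exact hv
  | @step i n h _ hr ih =>
    obtain ⟨k, rfl⟩ := Nat.exists_eq_add_of_lt h
    rw [show i + k + 1 - i = k + 1 by omega] at hr
    have hj := ih.jump (k := k) hr.2
    rwa [hr.1 (k + 1) le_rfl, ← descPath_add] at hj

theorem setOf_pathChain_succ (v : TreeVertex d) (f : ℕ → Fin d) (n : ℕ) :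
    {ω | PathChain ω v f (n + 1)} = ⋃ i ∈ Finset.range (n + 1), {ω | PathChain ω v f i} ∩
      reachEvent (descPath v f i) (fun j => f (i + j)) (n + 1 - i) := by
  ext ω
  simp only [Set.mem_ofPred_eq, Set.mem_iUnion, Finset.mem_range, Set.mem_inter_iff, exists_prop]
  constructor
  · rintro (_ | ⟨h, hi, hr⟩)
    exact ⟨_, h, hi, hr⟩
  · rintro ⟨i, h, hi, hr⟩
    exact .step h hi hr

/-- Only particles strictly before position $n$ matter. This strictness makes the event independent
of the particle at position $n$ and of the whole subtree below it. -/
theorem measurableSet_pathChain (v : TreeVertex d) (f : ℕ → Fin d) (n : ℕ) :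
    MeasurableSet[coordSigma (fun _ : TreeVertex d => (ℕ → TreeVertex d) × ℕ)
      {w | v.word <:+ w.word ∧ w.word.length < v.word.length + n}] {ω | PathChain ω v f n} := by
  induction n using Nat.strong_induction_on with
  | _ n ih =>
    cases n with
    | zero =>
      have : {ω | PathChain ω v f 0} = Set.univ := Set.eq_univ_of_forall fun _ => .zero
      rw [this]
      exact MeasurableSet.univ
    | succ n =>
      rw [setOf_pathChain_succ]
      refine Finset.measurableSet_biUnion _ fun i hi => ?_
      rw [Finset.mem_range] at hi
      refine MeasurableSet.inter (coordSigma_mono ?_ _ (ih i hi)) (measurableSet_reachEvent _ _ _ ?_)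
      · exact fun w hw => ⟨hw.1, hw.2.trans (by omega)⟩
      · exact ⟨suffix_descPath v f i, by rw [length_descPath]; omega⟩

theorem safLaw_real_inter {p : unitInterval} {S T : Set (TreeVertex d)} (hST : Disjoint S T)
    {A B : Set (TreeVertex d → (ℕ → TreeVertex d) × ℕ)}
    (hA : MeasurableSet[coordSigma (fun _ : TreeVertex d => (ℕ → TreeVertex d) × ℕ) S] A)
    (hB : MeasurableSet[coordSigma (fun _ : TreeVertex d => (ℕ → TreeVertex d) × ℕ) T] B) :
    (safLaw (homTree d) p).real (A ∩ B) =
      (safLaw (homTree d) p).real A * (safLaw (homTree d) p).real B :=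
  infinitePi_real_inter hST hA hB

/-- The last vertex before position `n + 1` whose particle reaches that position is itself
activated independently of this particle and of the particles behind it. -/
theorem safLaw_pathChain_succ_ge (hd : d ≠ 0) {p : unitInterval} (hp : p < 1) (v : TreeVertex d)
    (f : ℕ → Fin d) (n : ℕ) :
    ∑ m ∈ Finset.range (n + 1), (d / (d + 1) : ℝ) * (p / d) ^ (m + 1) *
        (1 - ∑ j ∈ Finset.range m, (d / (d + 1) : ℝ) * (p / d) ^ (j + 1)) *
        (safLaw (homTree d) p).real {ω | PathChain ω v f (n - m)} ≤
      (safLaw (homTree d) p).real {ω | PathChain ω v f (n + 1)} := by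
  set μ := safLaw (homTree d) p with hμ
  have : IsProbabilityMeasure μ := by rw [hμ, safLaw]; infer_instance
  let R : ℕ → Set (TreeVertex d → (ℕ → TreeVertex d) × ℕ) := fun m =>
    reachEvent (descPath v f (n - m)) (fun j => f (n - m + j)) (m + 1)
  -- No particle strictly between positions $n-m$ and $n+1$ reaches $n+1$. This makes the cases
  -- disjoint in $m$; its probability is bounded below by a union bound.
  let N : ℕ → Set (TreeVertex d → (ℕ → TreeVertex d) × ℕ) := fun m =>
    (⋃ j ∈ Finset.range m, R j)ᶜ
  let A : ℕ → Set (TreeVertex d → (ℕ → TreeVertex d) × ℕ) := fun m =>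
    {ω | PathChain ω v f (n - m)}
  have hR : ∀ m, μ.real (R m) = (d / (d + 1) : ℝ) * (p / d) ^ (m + 1) := fun m =>
    safLaw_reachEvent hd hp _ _ m
  have mR : ∀ {m} {S : Set (TreeVertex d)}, descPath v f (n - m) ∈ S →
      MeasurableSet[coordSigma (fun _ : TreeVertex d => (ℕ → TreeVertex d) × ℕ) S] (R m) :=
    fun h => measurableSet_reachEvent _ _ _ h
  have mN : ∀ {m}, m ≤ n → MeasurableSet[coordSigma (fun _ : TreeVertex d => (ℕ → TreeVertex d) × ℕ)
      {w : TreeVertex d | v.word.length + (n - m) < w.word.length}] (N m) := by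
    intro m hm
    refine (Finset.measurableSet_biUnion _ fun j hj => mR ?_).compl
    rw [Finset.mem_range] at hj
    rw [Set.mem_ofPred_eq, length_descPath]
    omega
  have mA : ∀ m, MeasurableSet[coordSigma (fun _ : TreeVertex d => (ℕ → TreeVertex d) × ℕ)
      {w : TreeVertex d | w.word.length < v.word.length + (n - m)}] (A m) := fun m =>
    coordSigma_mono (fun w hw => hw.2) _ (measurableSet_pathChain v f (n - m))
  have mAR : ∀ m, MeasurableSet[coordSigma (fun _ : TreeVertex d => (ℕ → TreeVertex d) × ℕ)
      {w : TreeVertex d | w.word.length ≤ v.word.length + (n - m)}] (A m ∩ R m) := by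
    refine fun m => (coordSigma_mono (fun w hw => ?_) _ (mA m)).inter (mR ?_)
    · exact (Set.mem_ofPred_eq ▸ hw : _ < _).le
    · exact (length_descPath v f (n - m)).le
  have hN : ∀ m, 1 - ∑ j ∈ Finset.range m, (d / (d + 1) : ℝ) * (p / d) ^ (j + 1) ≤
      μ.real (N m) := by
    intro m
    have hm : MeasurableSet (⋃ j ∈ Finset.range m, R j) :=
      Finset.measurableSet_biUnion _ fun j _ => coordSigma_le Set.univ _ (mR (Set.mem_univ _))
    have := measureReal_biUnion_finset_le (μ := μ) (Finset.range m) R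
    simp only [hR] at this
    rw [probReal_compl_eq_one_sub hm]
    linarith
  have hterm : ∀ m ∈ Finset.range (n + 1), (d / (d + 1) : ℝ) * (p / d) ^ (m + 1) *
      (1 - ∑ j ∈ Finset.range m, (d / (d + 1) : ℝ) * (p / d) ^ (j + 1)) * μ.real (A m) ≤
      μ.real (A m ∩ R m ∩ N m) := by
    intro m hm
    rw [Finset.mem_range] at hm
    have hdis : Disjoint {w : TreeVertex d | w.word.length ≤ v.word.length + (n - m)}
        {w : TreeVertex d | v.word.length + (n - m) < w.word.length} := by
      refine Set.disjoint_left.2 fun w h h' => ?_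
      rw [Set.mem_ofPred_eq] at h h'
      omega
    have h1 : μ.real (A m ∩ R m ∩ N m) = μ.real (A m ∩ R m) * μ.real (N m) :=
      safLaw_real_inter hdis (mAR m) (mN (by omega))
    have h2 : μ.real (A m ∩ R m) = μ.real (A m) * μ.real (R m) := by
      refine safLaw_real_inter (T := {descPath v f (n - m)}) ?_ (mA m) (mR (Set.mem_singleton _))
      rw [Set.disjoint_singleton_right, Set.mem_ofPred_eq, length_descPath]
      exact lt_irrefl _
    rw [h1, h2, hR]
    have h3 : 0 ≤ μ.real (A m) * ((d / (d + 1) : ℝ) * (p / d) ^ (m + 1)) :=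
      mul_nonneg measureReal_nonneg (by have := p.2.1; positivity)
    nlinarith [mul_le_mul_of_nonneg_left (hN m) h3]
  refine (Finset.sum_le_sum hterm).trans ?_
  rw [← measureReal_biUnion_finset]
  · refine measureReal_mono ?_ (measure_ne_top _ _)
    rw [setOf_pathChain_succ]
    intro ω hω
    simp only [Set.mem_iUnion, Finset.mem_range, exists_prop] at hω ⊢
    obtain ⟨m, hm, ⟨hA, hr⟩, -⟩ := hω
    refine ⟨n - m, by omega, hA, ?_⟩
    rwa [show n + 1 - (n - m) = m + 1 by omega]
  · have hlt : ∀ m m', m < m' → Disjoint (A m ∩ R m ∩ N m) (A m' ∩ R m' ∩ N m') := by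
      intro m m' h
      refine Set.disjoint_left.2 fun ω h1 h2 => h2.2 ?_
      simp only [Set.mem_iUnion, Finset.mem_range]
      exact ⟨m, h, h1.1.2⟩
    intro m _ m' _ hne
    rcases lt_or_gt_of_ne hne with h | h
    · exact hlt m m' h
    · exact (hlt m' m h).symm
  · intro m hm
    rw [Finset.mem_range] at hm
    exact (coordSigma_le _ _ (mAR m)).inter (coordSigma_le _ _ (mN (by omega)))

end Chain

/-! ### Renewal inequalities -/

/-- A lower bound valid on $N$ consecutive terms improves by the factor $H>1$ at the next term. The
index is chosen from `h` alone, since one $n$ must serve all vertices and all paths. -/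
theorem exists_two_le_of_renewal {h : ℕ → ℝ} (hh : ∀ m, 0 ≤ h m) (h0 : 0 < h 0) {N : ℕ}
    (hN : 1 < ∑ m ∈ Finset.range N, h m) :
    ∃ n, 1 ≤ n ∧ ∀ a : ℕ → ℝ, (∀ n, 0 ≤ a n) → a 0 = 1 →
      (∀ n, ∑ m ∈ Finset.range (n + 1), h m * a (n - m) ≤ a (n + 1)) → 2 ≤ a n := by
  set H := ∑ m ∈ Finset.range N, h m
  have hN1 : 1 ≤ N := by
    rcases Nat.eq_zero_or_pos N with rfl | h
    · simp [H] at hN; linarith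
    · exact h
  set b := min 1 (h 0)
  have hb : 0 < b := lt_min one_pos h0
  have hb1 : b ≤ 1 := min_le_left _ _
  have hbN : 0 < b ^ N := pow_pos hb N
  obtain ⟨K, hK⟩ := pow_unbounded_of_one_lt (2 / b ^ N) hN
  rw [div_lt_iff₀ hbN] at hK
  have hK' : 2 < H ^ (K + 1) * b ^ N := by
    rw [pow_succ]
    have : 0 < H ^ K * b ^ N := by linarith
    nlinarith
  refine ⟨(K + 1) * N, Nat.mul_pos K.succ_pos hN1, fun a ha ha0 hrec => ?_⟩
  have hblock : ∀ (x : ℝ) (n : ℕ), N ≤ n + 1 → (∀ m < N, x ≤ a (n - m)) → H * x ≤ a (n + 1) := by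
    intro x n hn hx
    refine le_trans ?_ (hrec n)
    rw [Finset.sum_mul]
    refine (Finset.sum_le_sum fun m hm => mul_le_mul_of_nonneg_left
      (hx m (Finset.mem_range.1 hm)) (hh m)).trans ?_
    exact Finset.sum_le_sum_of_subset_of_nonneg (Finset.range_subset_range.2 hn)
      fun m _ _ => mul_nonneg (hh m) (ha _)
  have hpow : ∀ n, b ^ n ≤ a n := by
    intro n
    induction n with
    | zero => simp [ha0]
    | succ n ih =>
      refine le_trans ?_ (hrec n)
      refine le_trans ?_ (Finset.single_le_sum (f := fun m => h m * a (n - m))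
        (fun m _ => mul_nonneg (hh m) (ha _)) (Finset.mem_range.2 n.succ_pos))
      rw [pow_succ, mul_comm]
      exact mul_le_mul (min_le_right _ _) ih (by positivity) (hh 0)
  -- The term with `h 0` alone gives this for $n\le N$; afterwards $H>1$ keeps the bound from
  -- decaying.
  have hlow : ∀ n, b ^ N ≤ a n := by
    intro n
    induction n using Nat.strong_induction_on with
    | _ n ih =>
      rcases le_or_gt n N with hn | hn
      · exact (pow_le_pow_of_le_one hb.le hb1 hn).trans (hpow n)
      · obtain ⟨n, rfl⟩ := Nat.exists_eq_succ_of_ne_zero (by omega : n ≠ 0)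
        have := hblock (b ^ N) n (by omega) fun m _ => ih _ (by omega)
        rw [Nat.succ_eq_add_one]
        nlinarith
  have hgrow : ∀ k n, k * N ≤ n → H ^ k * b ^ N ≤ a n := by
    intro k
    induction k with
    | zero => intro n _; simpa using hlow n
    | succ k ih =>
      intro n hn
      rw [Nat.succ_mul] at hn
      obtain ⟨n, rfl⟩ := Nat.exists_eq_succ_of_ne_zero (by omega : n ≠ 0)
      have := hblock (H ^ k * b ^ N) n (by omega) fun m hm => ih _ (by omega)
      rw [pow_succ, Nat.succ_eq_add_one]
      linarith
  exact hK'.le.trans (hgrow _ _ le_rfl)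

/-- The renewal weights exceed one in total. -/
theorem exists_one_lt_sum_weights {c p s : ℝ} (hp0 : 0 < p) (hp1 : p < 1) (hs0 : 0 < s)
    (hs1 : s < 1) (hc : c ^ 2 * p * (s * p) / (1 - s * p) < (1 + c) * p - 1) :
    ∃ N, 1 < ∑ m ∈ Finset.range N,
      c * p ^ (m + 1) * (1 - ∑ j ∈ Finset.range m, c * s ^ (j + 1)) := by
  have hps : s * p < 1 := by nlinarith
  have hps0 : 0 < s * p := by positivity
  have hgeom : ∀ m, ∑ j ∈ Finset.range m, c * s ^ (j + 1) = c * s * (1 - s ^ m) / (1 - s) := by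
    intro m
    have : ∀ j, c * s ^ (j + 1) = c * s * s ^ j := fun j => by ring
    simp only [this]
    rw [← Finset.mul_sum, geom_sum_eq hs1.ne]
    have h1 : s - 1 ≠ 0 := by linarith
    have h2 : 1 - s ≠ 0 := by linarith
    field_simp
    ring
  -- Once the inner sum is evaluated, the weights split into geometric series of ratios $p$ and
  -- $sp$.
  have h1 := (hasSum_geometric_of_lt_one hp0.le hp1).mul_left (c * p * (1 - c * s / (1 - s)))
  have h2 := (hasSum_geometric_of_lt_one hps0.le hps).mul_left (c * p * (c * s / (1 - s)))
  have h3 := h1.add h2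
  have hlim : 1 < c * p * (1 - c * s / (1 - s)) * (1 - p)⁻¹ +
      c * p * (c * s / (1 - s)) * (1 - s * p)⁻¹ := by
    have e1 : 1 - s ≠ 0 := by linarith
    have e2 : 1 - p ≠ 0 := by linarith
    have e3 : 1 - s * p ≠ 0 := by linarith
    have e4 : 1 - p * s ≠ 0 := by linarith
    -- The excess of the total weight over one is the margin in `hc` divided by $1-p$.
    have key : c * p * (1 - c * s / (1 - s)) * (1 - p)⁻¹ +
        c * p * (c * s / (1 - s)) * (1 - s * p)⁻¹ - 1 =
        ((1 + c) * p - 1 - c ^ 2 * p * (s * p) / (1 - s * p)) / (1 - p) := by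
      field_simp
      ring
    have : 0 < ((1 + c) * p - 1 - c ^ 2 * p * (s * p) / (1 - s * p)) / (1 - p) :=
      div_pos (by linarith) (by linarith)
    linarith
  obtain ⟨N, hN⟩ := (h3.tendsto_sum_nat.eventually (lt_mem_nhds hlim)).exists
  refine ⟨N, hN.trans_eq (Finset.sum_congr rfl fun m _ => ?_)⟩
  rw [hgeom, mul_pow]
  ring

/-! ### Survival -/

section Survival

variable {d : ℕ}

/-- Extension of a finite sequence of labels. -/
def extendLabels [NeZero d] {n : ℕ} (f : Fin n → Fin d) (j : ℕ) : Fin d :=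
  if h : j < n then f ⟨j, h⟩ else 0

theorem eq_of_descPath_extendLabels_eq [NeZero d] {n : ℕ} {f g : Fin n → Fin d}
    {v : TreeVertex d}
    (h : descPath v (extendLabels f) n = descPath v (extendLabels g) n) : f = g := by
  funext j
  have := eq_of_descPath_eq v h j j.2
  simpa [extendLabels] using this

/-- There are `k` successive generations of activated descendants of `v` at mutual distance `n`. -/
def generationEvent [NeZero d] (n : ℕ) : ℕ → TreeVertex d →
    Set (TreeVertex d → (ℕ → TreeVertex d) × ℕ)
  | 0, _ => Set.univ
  | k + 1, v => ⋃ f : Fin n → Fin d, {ω | PathChain ω v (extendLabels f) n} ∩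
      generationEvent n k (descPath v (extendLabels f) n)

theorem measurableSet_generationEvent [NeZero d] (n k : ℕ) (v : TreeVertex d) :
    MeasurableSet[coordSigma (fun _ : TreeVertex d => (ℕ → TreeVertex d) × ℕ)
      {w | v.word <:+ w.word}] (generationEvent n k v) := by
  induction k generalizing v with
  | zero => exact MeasurableSet.univ
  | succ k ih =>
    refine MeasurableSet.iUnion fun f => MeasurableSet.inter
      (coordSigma_mono (fun w hw => hw.1) _ (measurableSet_pathChain v _ n))
      (coordSigma_mono (fun w hw => ?_) _ (ih _))
    exact (suffix_descPath v _ n).trans hw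

theorem generationEvent_succ_subset [NeZero d] (n k : ℕ) (v : TreeVertex d) :
    generationEvent n (k + 1) v ⊆ generationEvent n k v := by
  induction k generalizing v with
  | zero => exact Set.subset_univ _
  | succ k ih =>
    exact Set.iUnion_mono fun f => Set.inter_subset_inter_right _ (ih _)

theorem exists_activated_of_mem_generationEvent [NeZero d] {n k : ℕ} {o v : TreeVertex d}
    {ω : TreeVertex d → (ℕ → TreeVertex d) × ℕ} (h : ω ∈ generationEvent n k v)
    (hv : Activated o ω v) :
    ∃ w : TreeVertex d, Activated o ω w ∧ w.word.length = v.word.length + k * n := by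
  induction k generalizing v with
  | zero => exact ⟨v, hv, by simp⟩
  | succ k ih =>
    obtain ⟨f, hf, hk⟩ := Set.mem_iUnion.1 h
    obtain ⟨w, hw, hl⟩ := ih hk (PathChain.activated hf hv)
    refine ⟨w, hw, ?_⟩
    rw [hl, length_descPath]
    ring

/-- This is the branching step with $\delta=d^{-n}$ and $M=d^n$ potential offspring: $1+M\delta=2$,
which is why a mean of two is required. -/
theorem safLaw_generationEvent_ge [NeZero d] {p : unitInterval} {n : ℕ}
    (h : ∀ (v : TreeVertex d) (f : ℕ → Fin d),
      2 ≤ (d : ℝ) ^ n * (safLaw (homTree d) p).real {ω | PathChain ω v f n})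
    (k : ℕ) (v : TreeVertex d) :
    ((d : ℝ) ^ n)⁻¹ ≤ (safLaw (homTree d) p).real (generationEvent n k v) := by
  have hd : (1 : ℝ) ≤ d := by exact_mod_cast NeZero.one_le
  have hdn : (1 : ℝ) ≤ (d : ℝ) ^ n := one_le_pow₀ hd
  have hμ : IsProbabilityMeasure (safLaw (homTree d) p) := by rw [safLaw]; infer_instance
  induction k generalizing v with
  | zero => simpa [generationEvent] using inv_le_one_of_one_le₀ hdn
  | succ k ih =>
    have hA : ∀ f : Fin n → Fin d, MeasurableSet[coordSigma
        (fun _ : TreeVertex d => (ℕ → TreeVertex d) × ℕ)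
        {w | v.word <:+ w.word ∧ w.word.length < v.word.length + n}]
        {ω | PathChain ω v (extendLabels f) n} :=
      fun f => measurableSet_pathChain v (extendLabels f) n
    have hE : ∀ f : Fin n → Fin d, MeasurableSet[coordSigma
        (fun _ : TreeVertex d => (ℕ → TreeVertex d) × ℕ)
        {w | (descPath v (extendLabels f) n).word <:+ w.word}]
        (generationEvent n k (descPath v (extendLabels f) n)) :=
      fun f => measurableSet_generationEvent n k (descPath v (extendLabels f) n)
    have hS : ∀ f : Fin n → Fin d, ((d : ℝ) ^ n)⁻¹ ≤
        (safLaw (homTree d) p).real (generationEvent n k (descPath v (extendLabels f) n)) :=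
      fun f => ih (descPath v (extendLabels f) n)
    rw [generationEvent]
    refine infinitePi_real_branching
      (X := fun _ : TreeVertex d => (ℕ → TreeVertex d) × ℕ)
      (T₀ := {w : TreeVertex d | v.word <:+ w.word ∧ w.word.length < v.word.length + n})
      (T := fun f : Fin n → Fin d =>
        {w : TreeVertex d | (descPath v (extendLabels f) n).word <:+ w.word})
      (A := fun f => {ω | PathChain ω v (extendLabels f) n})
      (E := fun f => generationEvent n k (descPath v (extendLabels f) n))
      ?_ ?_ hA hE (by positivity) (inv_le_one_of_one_le₀ hdn) hS ?_
    · intro f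
      refine Set.disjoint_left.2 fun w hw hw' => ?_
      have hw1 : (descPath v (extendLabels f) n).word <:+ w.word := hw'
      have hw2 := hw1.length_le
      have hw3 : w.word.length < v.word.length + n := hw.2
      rw [length_descPath] at hw2
      omega
    · intro f g hfg
      refine Set.disjoint_left.2 fun w hw hw' => hfg ?_
      apply eq_of_descPath_extendLabels_eq (v := v)
      apply TreeVertex.ext
      have hw1 : (descPath v (extendLabels f) n).word <:+ w.word := hw
      have hw2 : (descPath v (extendLabels g) n).word <:+ w.word := hw'
      refine (List.suffix_of_suffix_length_le hw1 hw2 ?_).eq_of_length ?_ <;>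
        simp [length_descPath]
    · have hcard : (Fintype.card (Fin n → Fin d) : ℝ) = (d : ℝ) ^ n := by simp
      have hle : ∀ f ∈ (Finset.univ : Finset (Fin n → Fin d)), 2 * ((d : ℝ) ^ n)⁻¹ ≤
          (safLaw (homTree d) p).real {ω | PathChain ω v (extendLabels f) n} := by
        intro f _
        rw [← div_eq_mul_inv, div_le_iff₀' (by positivity)]
        exact h v _
      have hs := Finset.card_nsmul_le_sum _ _ _ hle
      rw [Finset.card_univ, nsmul_eq_mul, hcard] at hs
      rw [hcard, mul_inv_cancel₀ (by positivity)]
      refine le_trans (le_of_eq ?_) hs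
      field_simp
      norm_num

theorem safSurvivalProb_pos [NeZero d] {p : unitInterval} {n : ℕ} (hn : 1 ≤ n)
    (h : ∀ (v : TreeVertex d) (f : ℕ → Fin d),
      2 ≤ (d : ℝ) ^ n * (safLaw (homTree d) p).real {ω | PathChain ω v f n}) :
    0 < safSurvivalProb (homTree d) (treeRoot d) p := by
  have hd : (0 : ℝ) < d := by exact_mod_cast Nat.pos_of_neZero d
  have hμ : IsProbabilityMeasure (safLaw (homTree d) p) := by rw [safLaw]; infer_instance
  set μ := safLaw (homTree d) p
  have hlim := tendsto_measure_iInter_atTop (μ := μ)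
    (s := fun k => generationEvent n k (treeRoot d))
    (fun k => (coordSigma_le _ _ (measurableSet_generationEvent n k _)).nullMeasurableSet)
    (antitone_nat_of_succ_le fun k => generationEvent_succ_subset n k _)
    ⟨0, measure_ne_top _ _⟩
  have hge : ENNReal.ofReal ((d : ℝ) ^ n)⁻¹ ≤ μ (⋂ k, generationEvent n k (treeRoot d)) :=
    ge_of_tendsto' hlim fun k => by
      rw [Function.comp_apply, ← ofReal_measureReal]
      exact ENNReal.ofReal_le_ofReal (safLaw_generationEvent_ge h k _)
  have hsub : (⋂ k, generationEvent n k (treeRoot d)) ⊆ {ω | FrogSurvives (treeRoot d) ω} := by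
    intro ω hω
    refine frogSurvives_of_infinite fun hfin => ?_
    -- Generation $b+1$ lies at depth $(b+1)n>b$ because $n\ge1$.
    obtain ⟨b, hb⟩ := (hfin.image fun w => w.word.length).bddAbove
    obtain ⟨w, hw, hl⟩ := exists_activated_of_mem_generationEvent (Set.mem_iInter.1 hω (b + 1))
      activated_origin
    have := hb ⟨w, hw, rfl⟩
    simp only [hl] at this
    nlinarith
  rw [safSurvivalProb, measureReal_def]
  refine ENNReal.toReal_pos ?_ (measure_ne_top _ _)
  refine (lt_of_lt_of_le ?_ (hge.trans (measure_mono hsub))).ne'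
  rw [ENNReal.ofReal_pos]
  positivity

theorem mem_safSurvivalSet (hd : 2 ≤ d) {p c : ℝ} (hc : c = d / (d + 1)) (hp0 : 0 < p)
    (hp1 : p < 1)
    (h : c ^ 2 * p * (p / d * p) / (1 - p / d * p) < (1 + c) * p - 1) :
    p ∈ safSurvivalSet d := by
  have : NeZero d := ⟨by omega⟩
  have hd2 : (2 : ℝ) ≤ d := by exact_mod_cast hd
  have hc0 : 0 < c := by rw [hc]; positivity
  have hc1 : c < 1 := by rw [hc, div_lt_one (by positivity)]; linarith
  set s := p / d with hs
  have hs0 : 0 < s := by positivity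
  have hs2 : s < 1 / 2 := by rw [hs, div_lt_iff₀ (by positivity)]; linarith
  have hsd : (d : ℝ) * s = p := by rw [hs]; field_simp
  obtain ⟨N, hN⟩ := exists_one_lt_sum_weights hp0 hp1 hs0 (by linarith) h
  -- Since $c<1$ and $s<1/2$, the inner sum is dominated by $\sum_{j\ge1}2^{-j}=1$.
  have hweight : ∀ m, 0 ≤ c * p ^ (m + 1) * (1 - ∑ j ∈ Finset.range m, c * s ^ (j + 1)) := by
    intro m
    have hle : ∑ j ∈ Finset.range m, c * s ^ (j + 1) ≤
        ∑ j ∈ Finset.range m, (1 / 2) * (1 / 2) ^ j := by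
      refine Finset.sum_le_sum fun j _ => ?_
      rw [← pow_succ']
      calc c * s ^ (j + 1) ≤ 1 * s ^ (j + 1) := by gcongr
        _ ≤ (1 / 2) ^ (j + 1) := by rw [one_mul]; gcongr
    have hg : ∑ j ∈ Finset.range m, (1 / 2 : ℝ) * (1 / 2) ^ j ≤ 1 := by
      rw [← Finset.mul_sum, geom_sum_eq (by norm_num), ← mul_div_assoc,
        div_le_iff_of_neg (by norm_num)]
      have : (0 : ℝ) ≤ (1 / 2) ^ m := by positivity
      linarith
    refine mul_nonneg (by positivity) ?_
    linarith
  obtain ⟨n, hn, hrenew⟩ := exists_two_le_of_renewal hweight (by simp; positivity) hN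
  refine ⟨⟨p, hp0.le, hp1.le⟩, rfl, by exact_mod_cast hp0, by exact_mod_cast hp1,
    safSurvivalProb_pos hn fun v f => ?_⟩
  set q : unitInterval := ⟨p, hp0.le, hp1.le⟩
  refine hrenew (fun n => (d : ℝ) ^ n * (safLaw (homTree d) q).real {ω | PathChain ω v f n})
    (fun n => by positivity) ?_ fun n => ?_
  · have hμ : IsProbabilityMeasure (safLaw (homTree d) q) := by rw [safLaw]; infer_instance
    have : {ω | PathChain ω v f 0} = Set.univ := Set.eq_univ_of_forall fun _ => .zero
    simp [this]
  · have hq := safLaw_pathChain_succ_ge (p := q) (by omega) (by exact_mod_cast hp1) v f n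
    rw [← hc, show ((q : ℝ) / d) = s from rfl] at hq
    have hq2 := mul_le_mul_of_nonneg_left hq (by positivity : (0 : ℝ) ≤ (d : ℝ) ^ (n + 1))
    refine le_trans (le_of_eq ?_) hq2
    rw [Finset.mul_sum]
    refine Finset.sum_congr rfl fun m hm => ?_
    -- One factor turns $s^{m+1}$ into $p^{m+1}$, the other normalises the chain probability; the
    -- inner sum keeps $s$.
    have hpow : (d : ℝ) ^ (n + 1) = (d : ℝ) ^ (m + 1) * (d : ℝ) ^ (n - m) := by
      rw [← pow_add]
      congr 1
      have := Finset.mem_range.1 hm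
      omega
    rw [hpow, ← hsd, mul_pow]
    ring

end Survival

/-! ### The explicit bounds -/

theorem safCriticalParam_le {d : ℕ} {x : ℝ} (h : x ∈ safSurvivalSet d) :
    safCriticalParam d ≤ x := by
  refine csInf_le ⟨0, ?_⟩ h
  rintro _ ⟨p, rfl, -⟩
  exact p.2.1

/-- The two sides of the criterion are about $0.0766$ and $0.0801$. -/
theorem mem_safSurvivalSet_two : (0.648046 : ℝ) ∈ safSurvivalSet 2 :=
  mem_safSurvivalSet le_rfl (c := 2 / 3) (by norm_num) (by norm_num) (by norm_num) (by norm_num)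

/-! ### Comparison with the earlier bound, and the quadratic for $d\ge3$. -/

theorem lt_oldBound_two : (0.648046 : ℝ) < oldBound 2 := by
  have h : √(4 * (2 : ℝ) ^ 2 - 3) < 3.7 := by
    rw [Real.sqrt_lt' (by norm_num)]
    norm_num
  rw [oldBound]
  linarith

theorem oldBound_eq {d : ℝ} (hd : 3 ≤ d) :
    (2 * d + 1) * oldBound d = oldBound d ^ 2 + d + 1 := by
  have h : √(4 * d ^ 2 - 3) ^ 2 = 4 * d ^ 2 - 3 := Real.sq_sqrt (by nlinarith)
  rw [oldBound]
  linear_combination -(1 / 4) * h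

theorem oldBound_le {d : ℝ} (hd : 3 ≤ d) : oldBound d ≤ 2 / 3 := by
  have h : 2 * d - 1 / 3 ≤ √(4 * d ^ 2 - 3) := Real.le_sqrt_of_sq_le (by nlinarith)
  rw [oldBound]
  linarith

theorem half_lt_oldBound {d : ℝ} (hd : 3 ≤ d) : 1 / 2 < oldBound d := by
  have h : √(4 * d ^ 2 - 3) < 2 * d := by
    rw [Real.sqrt_lt' (by linarith)]
    linarith
  rw [oldBound]
  linarith

/-- The new bound is the smaller root of a quadratic polynomial, which is negative at the old
bound. -/
theorem newBound_spec {d c : ℝ} (hd : 3 ≤ d) (hc : c = d / (d + 1)) :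
    0 < newBound d ∧ newBound d < oldBound d ∧
      (1 + c) * newBound d - 1 =
        8 / 7 * (c / (1 + c)) ^ 2 * (newBound d / d) * (1 + newBound d / d) := by
  have hd1 : 0 < d + 1 := by linarith
  have hd0 : 0 < d := by linarith
  have hcd : c * (d + 1) = d := by rw [hc]; field_simp
  have hc0 : 0 < c := by rw [hc]; positivity
  have hc1 : c < 1 := by rw [hc, div_lt_one hd1]; linarith
  have hF : 0 < boundF c d := by
    have h1 : 1 ≤ (c + 1) ^ 3 := one_le_pow₀ (by linarith)
    have h2 : c ^ 2 ≤ 1 := pow_le_one₀ hc0.le hc1.le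
    rw [boundF]
    nlinarith
  set F := boundF c d with hFdef
  set D := F ^ 2 - 224 * c ^ 2 * (c + 1) ^ 2 with hD
  set P := oldBound d with hP
  have hPeq : (2 * d + 1) * P = P ^ 2 + d + 1 := oldBound_eq hd
  have hPhalf : 1 / 2 < P := half_lt_oldBound hd
  -- The equation of the old bound gives $(1+c)P-1=P^2/(d+1)$, so the claim becomes
  -- $8(d+P)(d+1)<7P(2d+1)^2$, which follows from $1/2<P\le1$.
  have hold : 8 * (c / (1 + c)) ^ 2 * (P / d) * (1 + P / d) < 7 * ((1 + c) * P - 1) := by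
    have e1 : c / (1 + c) = d / (2 * d + 1) := by rw [hc]; field_simp; ring
    have e2 : (1 + c) * P - 1 = P ^ 2 / (d + 1) := by
      rw [hc]; field_simp; linear_combination hPeq
    have e3 : 8 * (d / (2 * d + 1)) ^ 2 * (P / d) * (1 + P / d) =
        8 * P * (d + P) / (2 * d + 1) ^ 2 := by field_simp
    rw [e1, e2, e3, ← mul_div_assoc, div_lt_div_iff₀ (by positivity) hd1]
    have hP1 : P ≤ 1 := (oldBound_le hd).trans (by norm_num)
    have h4 : 8 * (d + P) * (d + 1) < 7 * P * (2 * d + 1) ^ 2 := by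
      have : 8 * (d + P) * (d + 1) ≤ 8 * (d + 1) * (d + 1) := by nlinarith
      have : 7 * (1 / 2) * (2 * d + 1) ^ 2 ≤ 7 * P * (2 * d + 1) ^ 2 := by
        have : 0 ≤ (2 * d + 1) ^ 2 := by positivity
        nlinarith
      nlinarith
    nlinarith
  -- Completing the square: the roots satisfy $16c^2x/d=F\pm\sqrt D$, and positivity at $P$ places
  -- $P$ beyond the smaller one.
  have hpoly : ∀ x : ℝ, 7 * (1 + c) ^ 2 * (7 * ((1 + c) * x - 1) -
      8 * (c / (1 + c)) ^ 2 * (x / d) * (1 + x / d)) * (32 * c ^ 2) =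
      7 * (D - (F - 16 * c ^ 2 * x / d) ^ 2) := by
    intro x
    rw [hD, hFdef, boundF]
    field_simp
    ring
  have hquad : (F - 16 * c ^ 2 * P / d) ^ 2 < D := by
    have h1 := hpoly P
    have h2 : 0 < 7 * (1 + c) ^ 2 * (7 * ((1 + c) * P - 1) -
        8 * (c / (1 + c)) ^ 2 * (P / d) * (1 + P / d)) * (32 * c ^ 2) := by
      have := sub_pos.2 hold
      positivity
    linarith
  have hD0 : 0 < D := (sq_nonneg _).trans_lt hquad
  have hsq : √D ^ 2 = D := Real.sq_sqrt hD0.le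
  have hlt : F - 16 * c ^ 2 * P / d < √D := Real.lt_sqrt_of_sq_lt hquad
  have hDF : √D < F := by
    rw [Real.sqrt_lt' hF, hD]
    have : 0 < c ^ 2 * (c + 1) ^ 2 := by positivity
    linarith
  have hnew : newBound d = (d + 1) ^ 2 * (F - √D) / (16 * d) := by
    rw [newBound, ← hc]
  have hx : 16 * c ^ 2 * newBound d / d = F - √D := by
    have : c ^ 2 * (d + 1) ^ 2 = d ^ 2 := by rw [← mul_pow, hcd]
    rw [hnew]
    field_simp
    linear_combination (F - √D) * this
  refine ⟨?_, ?_, ?_⟩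
  · rw [hnew]
    have := sub_pos.2 hDF
    positivity
  · have h1 : 16 * c ^ 2 * newBound d / d < 16 * c ^ 2 * P / d := by linarith
    rw [div_lt_div_iff_of_pos_right hd0] at h1
    exact lt_of_mul_lt_mul_left h1 (by positivity)
  · have h1 := hpoly (newBound d)
    rw [hx, sub_sub_cancel, hsq, sub_self, mul_zero, mul_eq_zero, mul_eq_zero] at h1
    rcases h1 with (h1 | h1) | h1
    · exact absurd h1 (by positivity)
    · linarith
    · exact absurd h1 (by positivity)

/-- The criterion is cubic in $p$. Replacing $((1+c)p)^2/(1-sp)$ by its upper bound $\frac87(1+s)$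
gives the quadratic that `newBound` solves, so this bound is all that remains to be checked. -/
theorem newBound_mem_safSurvivalSet {d : ℕ} (hd : 3 ≤ d) :
    newBound d ∈ safSurvivalSet d := by
  have hd3 : (3 : ℝ) ≤ d := by exact_mod_cast hd
  obtain ⟨hp0, hlt, heq⟩ := newBound_spec hd3 rfl
  set p := newBound d
  have hp : p < 2 / 3 := hlt.trans_le (oldBound_le hd3)
  refine mem_safSurvivalSet (by omega) rfl hp0 (by linarith) ?_
  set c : ℝ := d / (d + 1) with hc
  have hc0 : 0 < c := by positivity
  have hc1 : c < 1 := by rw [hc, div_lt_one (by positivity)]; linarith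
  set s := p / d with hs
  have hs0 : 0 < s := by positivity
  have hs2 : s < 2 / 9 := by rw [hs, div_lt_iff₀ (by positivity)]; linarith
  have hsp : s * p < 1 := by nlinarith
  have hratio : (c / (1 + c)) ^ 2 ≤ 1 / 4 := by
    have : c / (1 + c) ≤ 1 / 2 := by rw [div_le_div_iff₀ (by positivity) (by norm_num)]; linarith
    have h0 : 0 ≤ c / (1 + c) := by positivity
    nlinarith
  have hss : 0 < s * (1 + s) := by positivity
  -- The quadratic equation itself keeps $(1+c)p$ near one: $\frac27=\frac87\cdot\frac14$, with
  -- $\frac14$ from `hratio`.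
  have ht : (1 + c) * p ≤ 1 + 2 / 7 * (s * (1 + s)) := by nlinarith
  have ht2 : ((1 + c) * p) ^ 2 ≤ (1 + 2 / 7 * (s * (1 + s))) ^ 2 :=
    pow_le_pow_left₀ (by positivity) ht 2
  have hmain : ((1 + c) * p) ^ 2 < 8 / 7 * (1 + s) * (1 - s * p) := by
    have h1 : (1 + s) * (1 - s * (2 / 3)) ≤ (1 + s) * (1 - s * p) := by gcongr
    have h2 : s * (1 + s) ≤ 11 / 9 * s := by nlinarith
    have h3 : (1 + 2 / 7 * (s * (1 + s))) ^ 2 ≤ (1 + 22 / 63 * s) ^ 2 :=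
      pow_le_pow_left₀ (by positivity) (by linarith) 2
    nlinarith
  rw [heq, div_lt_iff₀ (by linarith)]
  have hk : 0 < (c / (1 + c)) ^ 2 * s := by positivity
  have hcp : c ^ 2 * p * (s * p) = (c / (1 + c)) ^ 2 * s * ((1 + c) * p) ^ 2 := by
    field_simp
  rw [hcp]
  nlinarith [mul_lt_mul_of_pos_left hmain hk]

theorem proposition3 :
    ((safSurvivalSet 2).Nonempty ∧ safCriticalParam 2 ≤ 0.648046 ∧ (0.648046 : ℝ) < oldBound 2) ∧
    ∀ d : ℕ, 3 ≤ d →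
      (safSurvivalSet d).Nonempty ∧
      safCriticalParam d ≤ newBound d ∧
      newBound d < oldBound d := by
  refine ⟨⟨⟨_, mem_safSurvivalSet_two⟩, safCriticalParam_le mem_safSurvivalSet_two, lt_oldBound_two⟩,
    fun d hd => ?_⟩
  have h := newBound_mem_safSurvivalSet hd
  exact ⟨⟨_, h⟩, safCriticalParam_le h, (newBound_spec (by exact_mod_cast hd) rfl).2.1⟩
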